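/- Let $(\mathcal X,\mathcal A,\gamma,P,r)$ be a Markov decision process with finite state space $\mathcal X$, finite action space $\mathcal A$, transition kernel $P:\mathcal X\times\mathcal A\to\mathscr P(\mathcal X)$, reward function $r:\mathcal X\times\mathcal A\to\mathbb R$ and discount factor $\gamma\in[0,1)$, and let $\pi:\mathcal X\to\mathscr P(\mathcal A)$ be a policy. Put $r^\pi_x=\sum_a\pi(a|x)\,r(x,a)$ and $P^\pi_x=\sum_a\pi(a|x)P(\cdot|x,a)$, and let $U^\pi\in\mathbb R^{\mathcal X\times\mathcal X}$ be the unique fixed point of the operator $$(T^\pi_M U)(x,y)=|r^\pi_x-r^\pi_y|+\gamma\sum_{x',y'\in\mathcal X}P^\pi_x(x')\,P^\pi_y(y')\,U(x',y').$$ Suppose that rewards depend only on the state, i.e. $r(x,a)=r(x,b)$ for all $x\in\mathcal X$, $a,b\in\mathcal A$. On a probability space with a filtration $(\mathcal F_t)_{t\ge0}$, let $(x_t,a_t,r_t,x'_t)$ and $(y_t,b_t,\tilde r_t,y'_t)$, $t\ge0$, be pairs of transitions generated under $\pi$: the states $x_t,y_t$ are $\mathcal F_t$-measurable, $a_t,x'_t,b_t,y'_t$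 are $\mathcal F_{t+1}$-measurable, $r_t=r(x_t,a_t)$, $\tilde r_t=r(y_t,b_t)$, and almost surely, for all $a,b\in\mathcal A$ and $x',y'\in\mathcal X$, $$\mathbb P\big(a_t=a,\,x'_t=x',\,b_t=b,\,y'_t=y'\mid\mathcal F_t\big)=\pi(a|x_t)\,P(x'|x_t,a)\,\pi(b|y_t)\,P(y'|y_t,b).$$ Let the stepsizes $\epsilon_t(x,y)$, $(x,y)\in\mathcal X^2$, be real-valued and $\mathcal F_t$-measurable, let $U_0$ be an arbitrary $\mathcal F_0$-measurable random element of $\mathbb R^{\mathcal X\times\mathcal X}$ (for instance any deterministic one), and for $t\ge0$ define $$U_{t+1}(x_t,y_t)=(1-\epsilon_t(x_t,y_t))\,U_t(x_t,y_t)+\epsilon_t(x_t,y_t)\big(|r_t-\tilde r_t|+\gamma\,U_t(x'_t,y'_t)\big),$$ and $U_{t+1}(x,y)=U_t(x,y)$ for all $(x,y)\ne(x_t,y_t)$. Assume that almost surely, for every $(x,y)\in\mathcal X^2$, the pair $(x,y)$ is updated infinitely often (that is, $(x_t,y_t)=(x,y)$ for infinitely many $t$) and the stepsizes of these updates satisfy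 the Robbins–Monro conditions: $\epsilon_t(x,y)\ge0$ whenever $(x_t,y_t)=(x,y)$, and $$\sum_{t:(x_t,y_t)=(x,y)}\epsilon_t(x,y)=\infty,\qquad \sum_{t:(x_t,y_t)=(x,y)}\epsilon_t(x,y)^2<\infty.$$ Then $U_t\to U^\pi$ almost surely. -/

import Mathlib

open MeasureTheory ProbabilityTheory Filter Topology

noncomputable section

/-- A discounted Markov decision process with state space `X` and action space `A`
(both taken finite below). -/
structure MDP (X A : Type*) where
  /-- the transition kernel: `P x a` is the law of the next state -/
  P : X → A → PMF X
  /-- the reward function -/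
  r : X → A → ℝ
  /-- the discount factor -/
  γ : ℝ
  γ_nonneg : 0 ≤ γ
  γ_lt_one : γ < 1

namespace MDP

variable {X A : Type*}

/-- Rewards depend only on the state. -/
def StateRewards (M : MDP X A) : Prop :=
  ∀ x a b, M.r x a = M.r x b

/-- Expected one-step reward `∑ a, π(a|x) r(x,a)` under the policy `π`. -/
def rPi [Fintype A] (M : MDP X A) (π : X → PMF A) (x : X) : ℝ :=
  ∑ a, (π x a).toReal * M.r x a

/-- State-to-state transition law `∑ a, π(a|x) P(·|x,a)` under the policy `π`. -/
def PPi (M : MDP X A) (π : X → PMF A) (x : X) : PMF X :=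
  (π x).bind (M.P x)

/-- The MICo update operator. -/
def micoOp [Fintype X] [Fintype A] (M : MDP X A) (π : X → PMF A) (U : X × X → ℝ) :
    X × X → ℝ := fun p =>
  |M.rPi π p.1 - M.rPi π p.2| +
    M.γ * ∑ x', ∑ y', (M.PPi π p.1 x').toReal * (M.PPi π p.2 y').toReal * U (x', y')

theorem sum_toReal_pmf [Fintype X] (p : PMF X) : ∑ x, (p x).toReal = 1 := by
  rw [← ENNReal.toReal_sum (fun x _ => p.apply_ne_top x), ← tsum_fintype (L := .unconditional X),
    p.tsum_coe, ENNReal.toReal_one]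

/-- The MICo operator is a contraction for the sup norm. -/
theorem micoOp_contracting [Fintype X] [Fintype A] (M : MDP X A) (π : X → PMF A) :
    ContractingWith ⟨M.γ, M.γ_nonneg⟩ (M.micoOp π) := by
  refine ⟨by exact_mod_cast M.γ_lt_one, LipschitzWith.of_dist_le_mul fun U V => ?_⟩
  have hγ := M.γ_nonneg
  change dist _ _ ≤ M.γ * dist U V
  refine (dist_pi_le_iff (by positivity)).2 fun p => ?_
  have h : M.micoOp π U p - M.micoOp π V p = M.γ * ∑ x', ∑ y',
      (M.PPi π p.1 x').toReal * (M.PPi π p.2 y').toReal * (U (x', y') - V (x', y')) := by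
    simp only [micoOp, mul_sub, Finset.sum_sub_distrib]
    ring
  rw [Real.dist_eq, h, abs_mul, abs_of_nonneg hγ]
  refine mul_le_mul_of_nonneg_left ?_ hγ
  calc |∑ x', ∑ y', (M.PPi π p.1 x').toReal * (M.PPi π p.2 y').toReal *
          (U (x', y') - V (x', y'))|
      ≤ ∑ x', ∑ y', (M.PPi π p.1 x').toReal * (M.PPi π p.2 y').toReal * dist U V := by
        refine (Finset.abs_sum_le_sum_abs _ _).trans (Finset.sum_le_sum fun x' _ => ?_)
        refine (Finset.abs_sum_le_sum_abs _ _).trans (Finset.sum_le_sum fun y' _ => ?_)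
        rw [abs_mul, abs_of_nonneg (by positivity)]
        exact mul_le_mul_of_nonneg_left (dist_le_pi_dist U V (x', y')) (by positivity)
    _ = dist U V := by
        simp only [← Finset.sum_mul, ← Finset.mul_sum, sum_toReal_pmf, mul_one, one_mul]

/-- The MICo distance `U^π`: the unique fixed point of the MICo operator. -/
def UPi [Fintype X] [Fintype A] (M : MDP X A) (π : X → PMF A) : X × X → ℝ :=
  ContractingWith.fixedPoint (M.micoOp π) (M.micoOp_contracting π)

end MDP

/-- An observed transition `(x, a, r, x')`. -/
structure Transition (X A : Type*) where
  state : X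
  action : A
  reward : ℝ
  next : X

/-- One sampled MICo update of the table `U` with stepsizes `ε` from the two observed
transitions `o = (x, a, r, x')` and `o' = (y, b, r̃, y')`: only the entry `(x, y)` changes. -/
def micoUpdate {X A : Type*} [DecidableEq X] (γ : ℝ) (ε : X × X → ℝ)
    (o o' : Transition X A) (U : X × X → ℝ) : X × X → ℝ :=
  Function.update U (o.state, o'.state)
    ((1 - ε (o.state, o'.state)) * U (o.state, o'.state) +
      ε (o.state, o'.state) * (|o.reward - o'.reward| + γ * U (o.next, o'.next)))

/-- The estimates `U_t` obtained from the initial table `U₀`, the stepsizes `ε t` and the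
streams of transitions `τ t`, `τ' t`. -/
def micoIterate {X A : Type*} [DecidableEq X] (γ : ℝ) (ε : ℕ → X × X → ℝ)
    (τ τ' : ℕ → Transition X A) (U₀ : X × X → ℝ) : ℕ → X × X → ℝ
  | 0 => U₀
  | t + 1 => micoUpdate γ (ε t) (τ t) (τ' t) (micoIterate γ ε τ τ' U₀ t)

/-- The pairs of random transitions `(τ t, τ' t)` are generated in the MDP `M` under the
policy `π`, where `ℱ t` is the information available when the pair of states updated at time `t`
has been selected and its transitions have not been sampled yet: given `ℱ t`, the two
transitions are drawn independently from `π` and `P`, starting in those two states. -/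
structure GeneratedUnder {X A Ω : Type*} {mΩ : MeasurableSpace Ω} (M : MDP X A) (π : X → PMF A)
    (μ : Measure Ω) (ℱ : Filtration ℕ mΩ) (τ τ' : ℕ → Ω → Transition X A) : Prop where
  measurable_state : ∀ t,
    Measurable[ℱ t, ⊤] (fun ω => ((τ t ω).state, (τ' t ω).state))
  measurable_outcome : ∀ t,
    Measurable[ℱ (t + 1), ⊤] (fun ω =>
      (((τ t ω).action, (τ t ω).next), ((τ' t ω).action, (τ' t ω).next)))
  reward_eq : ∀ t ω, (τ t ω).reward = M.r (τ t ω).state (τ t ω).action ∧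
    (τ' t ω).reward = M.r (τ' t ω).state (τ' t ω).action
  cond_law : ∀ t (a b : A) (x' y' : X),
    μ⟦{ω | ((τ t ω).action = a ∧ (τ t ω).next = x') ∧
        ((τ' t ω).action = b ∧ (τ' t ω).next = y')} | ℱ t⟧
      =ᵐ[μ] fun ω =>
        ((π (τ t ω).state a).toReal * (M.P (τ t ω).state a x').toReal) *
        ((π (τ' t ω).state b).toReal * (M.P (τ' t ω).state b y').toReal)

/-- The pair of states `p` is updated at infinitely many times. -/
def UpdatedInfinitelyOften {X A : Type*} (τ τ' : ℕ → Transition X A) (p : X × X) : Prop :=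
  ∃ᶠ t in atTop, ((τ t).state, (τ' t).state) = p

/-- The Robbins-Monro conditions for the stepsizes used at the updates of the pair `p`: they are
nonnegative, their sum over the update times of `p` is infinite, and the sum of their squares
over these times is finite. -/
structure RobbinsMonro {X A : Type*} [DecidableEq X] (ε : ℕ → X × X → ℝ)
    (τ τ' : ℕ → Transition X A) (p : X × X) : Prop where
  nonneg : ∀ t, ((τ t).state, (τ' t).state) = p → 0 ≤ ε t p
  sum_eq_top : Tendsto
    (fun n => ∑ t ∈ Finset.range n, if ((τ t).state, (τ' t).state) = p then ε t p else 0)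
    atTop atTop
  summable_sq : Summable
    (fun t => if ((τ t).state, (τ' t).state) = p then ε t p ^ 2 else 0)

end

/-! Since rewards ignore the action, the observed gap `|r_t - r̃_t|` is exactly `|r^π_x - r^π_y|`.
The sampled target is therefore the MICo operator applied to `U_t`, read at the observed pair, plus
noise coming from the next states alone: `γ ∑ q, U_t q * ξ_t q`, where the `ξ_t q` are bounded
martingale differences (`sampled_target_eq`, `GeneratedUnder.condExp_nextNoise`).

Boundedness of the iterates is a pathwise fact: the steps eventually lie in `[0, 1]` and a target
has size at most `R + γ ‖U_t‖`. Hence the weights `α_t U_t q` are adapted and square-summable, and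
the noise series `∑ α_t U_t q ξ_t q` converges almost surely
(`ae_exists_tendsto_transform_of_summable_sq`).

The rest is deterministic (`tendsto_zero_of_contracting_recursion`). Shifting the error by the tail
of the noise series removes the noise, and `∑ α = ∞` makes the recursion forget its past, so the
`γ`-contraction turns any eventual bound `C` on the error into `(1 + γ) / 2 * C`. -/

/-! ### Deterministic recursions along a path -/

/-- If `d (t + 1) ≤ (1 - α t) d t + α t G` with steps in `[0, 1]` and `∑ α = ∞`, then `d` is eventually below `G + δ`. -/
theorem eventually_le_of_averaging {α d : ℕ → ℝ} {G δ : ℝ} (hδ : 0 < δ)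
    (hα : ∀ᶠ t in atTop, 0 ≤ α t ∧ α t ≤ 1)
    (hsum : Tendsto (fun n => ∑ t ∈ Finset.range n, α t) atTop atTop)
    (hd : ∀ᶠ t in atTop, d (t + 1) ≤ (1 - α t) * d t + α t * G) :
    ∀ᶠ t in atTop, d t ≤ G + δ := by
  obtain ⟨T, hT⟩ := eventually_atTop.1 (hα.and hd)
  set S : ℕ → ℝ := fun n => ∑ t ∈ Finset.range n, α t
  -- The excess over `G` is multiplied by at most `1 - α t ≤ exp (-α t)`, and the exponents add up
  -- to a divergent sum.
  have key : ∀ t, T ≤ t → d t - G ≤ Real.exp (-(S t - S T)) * |d T - G| := by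
    intro t ht
    induction t, ht using Nat.le_induction with
    | base => simpa using le_abs_self (d T - G)
    | succ t ht ih =>
      obtain ⟨⟨h0, h1⟩, h2⟩ := hT t ht
      have hS : S (t + 1) = S t + α t := Finset.sum_range_succ _ _
      have e1 : 1 - α t ≤ Real.exp (-α t) := by
        have := Real.add_one_le_exp (-α t); linarith
      calc d (t + 1) - G ≤ (1 - α t) * (d t - G) := by linarith
        _ ≤ (1 - α t) * (Real.exp (-(S t - S T)) * |d T - G|) :=
          mul_le_mul_of_nonneg_left ih (by linarith)
        _ ≤ Real.exp (-α t) * (Real.exp (-(S t - S T)) * |d T - G|) :=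
          mul_le_mul_of_nonneg_right e1 (by positivity)
        _ = Real.exp (-(S (t + 1) - S T)) * |d T - G| := by
          rw [← mul_assoc, ← Real.exp_add, hS]; ring_nf
  have hlim : Tendsto (fun t => Real.exp (-(S t - S T)) * |d T - G|) atTop (𝓝 0) := by
    have h1 : Tendsto (fun t => S t - S T) atTop atTop :=
      tendsto_atTop_add_const_right _ _ hsum
    simpa using (Real.tendsto_exp_neg_atTop_nhds_zero.comp h1).mul_const |d T - G|
  filter_upwards [eventually_ge_atTop T, hlim.eventually (gt_mem_nhds hδ)] with t ht h
  linarith [key t ht]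

/-- A scalar stochastic-approximation recursion driven by a drift of size at most `G` and a
summable noise is eventually of size at most `G + δ`. -/
theorem eventually_abs_le_of_recursion {α v g w : ℕ → ℝ} {G δ l : ℝ} (hδ : 0 < δ)
    (hα : ∀ᶠ t in atTop, 0 ≤ α t ∧ α t ≤ 1)
    (hsum : Tendsto (fun n => ∑ t ∈ Finset.range n, α t) atTop atTop)
    (hw : Tendsto (fun n => ∑ t ∈ Finset.range n, α t * w t) atTop (𝓝 l))
    (hg : ∀ᶠ t in atTop, |g t| ≤ G)
    (hv : ∀ t, v (t + 1) = (1 - α t) * v t + α t * (g t + w t)) :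
    ∀ᶠ t in atTop, |v t| ≤ G + δ := by
  set s : ℕ → ℝ := fun n => ∑ t ∈ Finset.range n, α t * w t with hs
  have hr : Tendsto (fun t => |l - s t|) atTop (𝓝 0) := by
    simpa using (hw.const_sub l).abs
  have hr' := hr.eventually (gt_mem_nhds (show 0 < δ / 3 by positivity))
  -- Adding the tail `l - s t` to `v t` cancels the noise: the shifted sequence averages with `g t +
  -- (l - s t)`, and the tail tends to zero.
  have hd : ∀ᶠ t in atTop, |v (t + 1) + (l - s (t + 1))| ≤
      (1 - α t) * |v t + (l - s t)| + α t * (G + δ / 3) := by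
    filter_upwards [hα, hg, hr'] with t h1 h2 h3
    have hst : s (t + 1) = s t + α t * w t := Finset.sum_range_succ _ _
    have e : v (t + 1) + (l - s (t + 1)) =
        (1 - α t) * (v t + (l - s t)) + α t * (g t + (l - s t)) := by
      rw [hst, hv]; ring
    rw [e]
    refine (abs_add_le _ _).trans ?_
    rw [abs_mul, abs_mul, abs_of_nonneg h1.1, abs_of_nonneg (sub_nonneg.2 h1.2)]
    gcongr
    · exact h1.1
    · exact (abs_add_le _ _).trans (by linarith)
  filter_upwards [eventually_le_of_averaging (d := fun t => |v t + (l - s t)|)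
    (show 0 < δ / 3 by positivity) hα hsum hd, hr'] with t h1 h2
  have : |v t| ≤ |v t + (l - s t)| + |l - s t| := by
    simpa using abs_sub (v t + (l - s t)) (l - s t)
  linarith

/-- Asynchronous stochastic approximation along a path: bounded iterates with a drift that
contracts the sup norm and with summable noises tend to zero. -/
theorem tendsto_zero_of_contracting_recursion {ι : Type*} [Fintype ι] {α V g w : ℕ → ι → ℝ}
    {γ B : ℝ} (hγ0 : 0 ≤ γ) (hγ : γ < 1)
    (hα : ∀ i, ∀ᶠ t in atTop, 0 ≤ α t i ∧ α t i ≤ 1)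
    (hsum : ∀ i, Tendsto (fun n => ∑ t ∈ Finset.range n, α t i) atTop atTop)
    (hw : ∀ i, ∃ l, Tendsto (fun n => ∑ t ∈ Finset.range n, α t i * w t i) atTop (𝓝 l))
    (hg : ∀ t i, |g t i| ≤ γ * ‖V t‖)
    (hV : ∀ t i, V (t + 1) i = (1 - α t i) * V t i + α t i * (g t i + w t i))
    (hB : ∀ᶠ t in atTop, ‖V t‖ ≤ B) :
    Tendsto V atTop (𝓝 0) := by
  -- The drift is at most `γ * C`; a slack of `(1 - γ) / 2 * C` gives the factor `(1 + γ) / 2`,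
  -- still below one.
  have step : ∀ C : ℝ, 0 < C → (∀ᶠ t in atTop, ‖V t‖ ≤ C) →
      ∀ᶠ t in atTop, ‖V t‖ ≤ (1 + γ) / 2 * C := by
    intro C hC h
    have h1 : ∀ i, ∀ᶠ t in atTop, |V t i| ≤ γ * C + (1 - γ) / 2 * C := fun i => by
      obtain ⟨l, hl⟩ := hw i
      refine eventually_abs_le_of_recursion (by have := sub_pos.2 hγ; positivity)
        (hα i) (hsum i) hl (g := fun t => g t i) ?_ (fun t => hV t i)
      filter_upwards [h] with t ht
      exact (hg t i).trans (mul_le_mul_of_nonneg_left ht hγ0)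
    filter_upwards [eventually_all.2 h1] with t ht
    refine (pi_norm_le_iff_of_nonneg (by positivity)).2 fun i => ?_
    rw [Real.norm_eq_abs]
    linarith [ht i]
  have hC : 0 < max B 1 := lt_max_of_lt_right one_pos
  have iter : ∀ n : ℕ, ∀ᶠ t in atTop, ‖V t‖ ≤ ((1 + γ) / 2) ^ n * max B 1 := by
    intro n
    induction n with
    | zero => filter_upwards [hB] with t ht; simpa using Or.inl ht
    | succ n ih =>
      have := step _ (by positivity) ih
      filter_upwards [this] with t ht
      rwa [pow_succ', mul_assoc]
  rw [tendsto_zero_iff_norm_tendsto_zero]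
  refine tendsto_order.2 ⟨fun a ha => Eventually.of_forall fun t => ha.trans_le (norm_nonneg _),
    fun a ha => ?_⟩
  have hl : Tendsto (fun n : ℕ => ((1 + γ) / 2) ^ n * max B 1) atTop (𝓝 0) := by
    simpa using (tendsto_pow_atTop_nhds_zero_of_lt_one (r := (1 + γ) / 2) (by linarith)
      (by linarith)).mul_const (max B 1)
  obtain ⟨n, hn⟩ := (hl.eventually (gt_mem_nhds ha)).exists
  filter_upwards [iter n] with t ht using ht.trans_lt hn

/-- Iterates that average their current value with a target of size at most `R + γ ‖U‖` are
bounded. -/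
theorem exists_eventually_norm_le_of_averaging {ι : Type*} [Fintype ι] {α U y : ℕ → ι → ℝ}
    {γ R : ℝ} (hγ : γ < 1)
    (hα : ∀ i, ∀ᶠ t in atTop, 0 ≤ α t i ∧ α t i ≤ 1)
    (hy : ∀ t i, |y t i| ≤ R + γ * ‖U t‖) (hγ0 : 0 ≤ γ)
    (hU : ∀ t i, U (t + 1) i = (1 - α t i) * U t i + α t i * y t i) :
    ∃ B, ∀ᶠ t in atTop, ‖U t‖ ≤ B := by
  obtain ⟨T, hT⟩ := eventually_atTop.1 (eventually_all.2 hα)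
  -- `R / (1 - γ)` is the threshold above which `R + γ * B ≤ B`, so the ball of radius `B` is
  -- invariant from time `T` on.
  set B := max ‖U T‖ (R / (1 - γ)) with hB
  have hR : R + γ * B ≤ B := by
    have := (div_le_iff₀ (sub_pos.2 hγ)).1 (le_max_right ‖U T‖ (R / (1 - γ)))
    rw [← hB] at this; linarith
  have hB0 : 0 ≤ B := (norm_nonneg _).trans (le_max_left _ _)
  refine ⟨B, eventually_atTop.2 ⟨T, fun t ht => ?_⟩⟩
  induction t, ht using Nat.le_induction with
  | base => exact le_max_left _ _
  | succ t ht ih =>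
    refine (pi_norm_le_iff_of_nonneg hB0).2 fun i => ?_
    obtain ⟨h0, h1⟩ := hT t ht i
    have h2 : |y t i| ≤ B :=
      (hy t i).trans ((add_le_add_right (mul_le_mul_of_nonneg_left ih hγ0) R).trans hR)
    have h3 : |U t i| ≤ B := (norm_le_pi_norm (U t) i).trans ih
    rw [Real.norm_eq_abs, hU]
    refine (abs_add_le _ _).trans ?_
    rw [abs_mul, abs_mul, abs_of_nonneg h0, abs_of_nonneg (sub_nonneg.2 h1)]
    nlinarith

/-! ### Almost sure convergence of martingale transforms -/

section MartingaleTransform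

variable {Ω : Type*} {mΩ : MeasurableSpace Ω} {μ : Measure Ω} [IsProbabilityMeasure μ]
  {ℱ : Filtration ℕ mΩ} {f ξ : ℕ → Ω → ℝ}

/-- The transform of bounded martingale differences by an adapted sequence with uniformly bounded
sum of squares converges almost surely. -/
theorem ae_exists_tendsto_transform_of_sum_sq_le {N : ℝ}
    (hf : ∀ t, Measurable[ℱ t] (f t)) (hξ : ∀ t, Measurable[ℱ (t + 1)] (ξ t))
    (hξ1 : ∀ t ω, |ξ t ω| ≤ 1) (hξ0 : ∀ t, μ[ξ t | ℱ t] =ᵐ[μ] 0)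
    (hN : ∀ n ω, ∑ t ∈ Finset.range n, f t ω ^ 2 ≤ N) :
    ∀ᵐ ω ∂μ, ∃ l, Tendsto (fun n => ∑ t ∈ Finset.range n, f t ω * ξ t ω) atTop (𝓝 l) := by
  set S : ℕ → Ω → ℝ := fun n ω => ∑ t ∈ Finset.range n, f t ω * ξ t ω with hS
  have hSsucc : ∀ n ω, S (n + 1) ω = S n ω + f n ω * ξ n ω := fun n ω =>
    Finset.sum_range_succ _ _
  have hfb : ∀ t ω, |f t ω| ≤ 1 + N := fun t ω => by
    have h1 : f t ω ^ 2 ≤ N := le_trans (Finset.single_le_sum (f := fun t => f t ω ^ 2)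
      (fun i _ => sq_nonneg _) (Finset.self_mem_range_succ t)) (hN (t + 1) ω)
    have h2 := sq_abs (f t ω)
    nlinarith [sq_nonneg (|f t ω| - 1), abs_nonneg (f t ω)]
  have hprod : ∀ t ω, |f t ω * ξ t ω| ≤ 1 + N := fun t ω => by
    rw [abs_mul]
    exact (mul_le_of_le_one_right (abs_nonneg _) (hξ1 t ω)).trans (hfb t ω)
  have hSb : ∀ n ω, |S n ω| ≤ n * (1 + N) := fun n ω => by
    refine (Finset.abs_sum_le_sum_abs _ _).trans ?_
    simpa [abs_mul, mul_add] using
      Finset.sum_le_card_nsmul (Finset.range n) _ _ fun t _ => hprod t ω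
  have hξm : ∀ t, Measurable (ξ t) := fun t => (hξ t).mono (ℱ.le _) le_rfl
  have hfm : ∀ t, Measurable (f t) := fun t => (hf t).mono (ℱ.le _) le_rfl
  have hSF : ∀ n, Measurable[ℱ n] (S n) := fun n =>
    Finset.measurable_fun_sum _ fun t ht =>
      ((hf t).mono (ℱ.mono (Finset.mem_range.1 ht).le) le_rfl).mul
        ((hξ t).mono (ℱ.mono (Finset.mem_range.1 ht)) le_rfl)
  have hSm : ∀ n, Measurable (S n) := fun n => (hSF n).mono (ℱ.le _) le_rfl
  have hξi : ∀ t, Integrable (ξ t) μ := fun t =>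
    .of_bound (hξm t).aestronglyMeasurable 1 (ae_of_all _ (hξ1 t))
  have hzero : ∀ t (g : Ω → ℝ) (c : ℝ), Measurable[ℱ t] g → (∀ ω, |g ω| ≤ c) →
      μ[g * ξ t | ℱ t] =ᵐ[μ] 0 := fun t g c hg hc => by
    refine (condExp_stronglyMeasurable_mul_of_bound (ℱ.le t) hg.stronglyMeasurable (hξi t) c
      (ae_of_all _ hc)).trans ?_
    filter_upwards [hξ0 t] with ω h
    simp [h]
  have hSi : ∀ n, Integrable (S n) μ := fun n =>
    .of_bound (hSm n).aestronglyMeasurable _ (ae_of_all _ (hSb n))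
  have hmart : Martingale S ℱ μ := by
    refine martingale_of_condExp_sub_eq_zero_nat (fun n => (hSF n).stronglyMeasurable) hSi
      fun n => ?_
    have : S (n + 1) - S n = f n * ξ n := by
      ext ω; simp [hSsucc]
    rw [this]
    exact hzero n _ _ (hf n) (hfb n)
  have hf2i : ∀ n, Integrable (fun ω => f n ω ^ 2) μ := fun n => by
    refine .of_bound ((hfm n).pow_const 2).aestronglyMeasurable N (ae_of_all _ fun ω => ?_)
    rw [Real.norm_eq_abs, abs_of_nonneg (sq_nonneg _)]
    exact le_trans (Finset.single_le_sum (f := fun t => f t ω ^ 2)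
      (fun i _ => sq_nonneg _) (Finset.self_mem_range_succ n)) (hN (n + 1) ω)
  have hS2i : ∀ n, Integrable (fun ω => S n ω ^ 2) μ := fun n => by
    refine .of_bound ((hSm n).pow_const 2).aestronglyMeasurable ((n * (1 + N)) ^ 2)
      (ae_of_all _ fun ω => ?_)
    rw [norm_pow]
    exact pow_le_pow_left₀ (norm_nonneg _) (hSb n ω) 2
  -- Increments are orthogonal to the past: the cross term has mean zero because `2 * S n * f n` is
  -- bounded and known at time `n`.
  have hsq : ∀ n, ∫ ω, S n ω ^ 2 ∂μ ≤ ∑ t ∈ Finset.range n, ∫ ω, f t ω ^ 2 ∂μ := by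
    intro n
    induction n with
    | zero => simp [hS]
    | succ n ih =>
      have hgb : ∀ ω, |2 * S n ω * f n ω| ≤ 2 * (n * (1 + N)) * (1 + N) := fun ω => by
        have h0 := abs_nonneg (S n ω)
        have h1 := hSb n ω
        rw [abs_mul, abs_mul, abs_two]
        exact mul_le_mul (by linarith) (hfb n ω) (abs_nonneg _) (by linarith)
      have hgF : Measurable[ℱ n] (fun ω => 2 * S n ω * f n ω) := ((hSF n).const_mul 2).mul (hf n)
      have hgi : Integrable (fun ω => 2 * S n ω * f n ω * ξ n ω) μ :=
        (hξi n).bdd_mul (hgF.mono (ℱ.le _) le_rfl).aestronglyMeasurable (ae_of_all _ hgb)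
      have hcross : ∫ ω, 2 * S n ω * f n ω * ξ n ω ∂μ = 0 := by
        have h := integral_condExp (μ := μ) (f := (fun ω => 2 * S n ω * f n ω) * ξ n) (ℱ.le n)
        rw [integral_congr_ae (hzero n _ _ hgF hgb)] at h
        simpa using h.symm
      have hle : ∀ ω, S (n + 1) ω ^ 2 ≤
          S n ω ^ 2 + 2 * S n ω * f n ω * ξ n ω + f n ω ^ 2 := fun ω => by
        have h1 : ξ n ω ^ 2 ≤ 1 := (sq_le_one_iff_abs_le_one _).2 (hξ1 n ω)
        have h2 := mul_le_mul_of_nonneg_left h1 (sq_nonneg (f n ω))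
        rw [hSsucc]
        nlinarith
      calc ∫ ω, S (n + 1) ω ^ 2 ∂μ
          ≤ ∫ ω, (S n ω ^ 2 + 2 * S n ω * f n ω * ξ n ω + f n ω ^ 2) ∂μ :=
            integral_mono (hS2i (n + 1)) (((hS2i n).add hgi).add (hf2i n)) hle
        _ = ∫ ω, S n ω ^ 2 ∂μ + ∫ ω, f n ω ^ 2 ∂μ := by
            have h1 := integral_add ((hS2i n).add hgi) (hf2i n)
            simp only [Pi.add_apply] at h1
            rw [h1, integral_add (hS2i n) hgi, hcross, add_zero]
        _ ≤ _ := by rw [Finset.sum_range_succ]; linarith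
  -- From `|S| ≤ 1 + S ^ 2`, the second-moment bound gives an `L¹` bound uniform in `n`, as
  -- submartingale convergence requires.
  have hL1 : ∀ n, eLpNorm (S n) 1 μ ≤ ((1 + N).toNNReal : ENNReal) := fun n => by
    rw [eLpNorm_one_eq_lintegral_enorm, ← ofReal_integral_norm_eq_lintegral_enorm (hSi n)]
    refine ENNReal.ofReal_le_ofReal ?_
    have h1 : ∫ ω, ‖S n ω‖ ∂μ ≤ ∫ ω, (1 + S n ω ^ 2) ∂μ :=
      integral_mono (hSi n).norm ((integrable_const 1).add (hS2i n)) fun ω => by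
        have := sq_abs (S n ω)
        simp only [Real.norm_eq_abs]
        nlinarith [sq_nonneg (|S n ω| - 1), abs_nonneg (S n ω)]
    have h2 : ∑ t ∈ Finset.range n, ∫ ω, f t ω ^ 2 ∂μ ≤ N := by
      rw [← integral_finsetSum _ fun t _ => hf2i t]
      calc _ ≤ ∫ _, N ∂μ :=
            integral_mono (integrable_finsetSum _ fun t _ => hf2i t) (integrable_const N) (hN n)
        _ = N := by simp
    rw [integral_add (integrable_const 1) (hS2i n)] at h1
    simp only [integral_const, probReal_univ, smul_eq_mul, mul_one] at h1
    linarith [hsq n]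
  exact hmart.submartingale.exists_ae_tendsto_of_bdd hL1

/-- The transform of bounded martingale differences by an adapted, almost surely square-summable
sequence converges almost surely. -/
theorem ae_exists_tendsto_transform_of_summable_sq
    (hf : ∀ t, Measurable[ℱ t] (f t)) (hξ : ∀ t, Measurable[ℱ (t + 1)] (ξ t))
    (hξ1 : ∀ t ω, |ξ t ω| ≤ 1) (hξ0 : ∀ t, μ[ξ t | ℱ t] =ᵐ[μ] 0)
    (hsum : ∀ᵐ ω ∂μ, Summable fun t => f t ω ^ 2) :
    ∀ᵐ ω ∂μ, ∃ l, Tendsto (fun n => ∑ t ∈ Finset.range n, f t ω * ξ t ω) atTop (𝓝 l) := by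
  classical
  set Q : ℕ → Ω → ℝ := fun n ω => ∑ t ∈ Finset.range n, f t ω ^ 2 with hQ
  have hQsucc : ∀ n ω, Q (n + 1) ω = Q n ω + f n ω ^ 2 := fun n ω => Finset.sum_range_succ _ _
  -- `Q (n + 1)` involves only `f 0, …, f n`, so cutting off at time `n` by its value keeps the
  -- weights adapted.
  have hQF : ∀ n, Measurable[ℱ n] (Q (n + 1)) := fun n =>
    Finset.measurable_fun_sum _ fun t ht =>
      ((hf t).mono (ℱ.mono (Nat.lt_succ_iff.1 (Finset.mem_range.1 ht))) le_rfl).pow_const 2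
  have htrunc : ∀ N : ℕ, ∀ᵐ ω ∂μ, ∃ l, Tendsto (fun n => ∑ t ∈ Finset.range n,
      (if Q (t + 1) ω ≤ N then f t ω else 0) * ξ t ω) atTop (𝓝 l) := fun N => by
    refine ae_exists_tendsto_transform_of_sum_sq_le (N := N)
      (f := fun t ω => if Q (t + 1) ω ≤ N then f t ω else 0) (fun t => ?_) hξ hξ1 hξ0
      fun n ω => ?_
    · exact Measurable.ite (measurableSet_le (hQF t) measurable_const) (hf t) measurable_const
    -- The minimum with `Q n ω` makes the induction close: a term is kept only if `Q (n + 1) ω ≤ N`,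
    -- and then the kept sum is still at most `Q (n + 1) ω`.
    · have h : ∑ t ∈ Finset.range n, (if Q (t + 1) ω ≤ N then f t ω else 0) ^ 2 ≤
          min (Q n ω) N := by
        induction n with
        | zero => simp [hQ]
        | succ n ih =>
          rw [Finset.sum_range_succ]
          have := le_min_iff.1 ih
          have hs := hQsucc n ω
          have := sq_nonneg (f n ω)
          split_ifs with hc
          · exact le_min (by linarith) (by linarith)
          · exact le_min (by linarith) (by linarith)
      exact h.trans (min_le_right _ _)
  filter_upwards [ae_all_iff.2 htrunc, hsum] with ω h hs
  -- On this path the cutoff at level `N` never acts.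
  obtain ⟨N, hN⟩ := exists_nat_ge (∑' t, f t ω ^ 2)
  have hle : ∀ t, Q (t + 1) ω ≤ N := fun t =>
    (hs.sum_le_tsum _ fun i _ => sq_nonneg _).trans hN
  simpa only [hle, if_true] using h N

end MartingaleTransform

/-! ### Policy averages -/

namespace MDP

variable {X A : Type*} [Fintype A]

theorem StateRewards.rPi_eq {M : MDP X A} (hr : M.StateRewards) (π : X → PMF A) (x : X) (a : A) :
    M.rPi π x = M.r x a := by
  have h : ∀ b, (π x b).toReal * M.r x b = (π x b).toReal * M.r x a := fun b => by rw [hr x b a]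
  simp only [rPi, h, ← Finset.sum_mul, sum_toReal_pmf, one_mul]

theorem toReal_PPi (M : MDP X A) (π : X → PMF A) (x x' : X) :
    (M.PPi π x x').toReal = ∑ a, (π x a).toReal * (M.P x a x').toReal := by
  rw [PPi, PMF.bind_apply, tsum_fintype, ENNReal.toReal_sum fun a _ =>
    ENNReal.mul_ne_top ((π x).apply_ne_top a) ((M.P x a).apply_ne_top x')]
  simp only [ENNReal.toReal_mul]

end MDP

theorem PMF.toReal_apply_le_one {X : Type*} (p : PMF X) (x : X) : (p x).toReal ≤ 1 :=
  ENNReal.toReal_le_of_le_ofReal zero_le_one (by simpa using p.coe_le_one x)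

/-! ### The update as a recursion in every coordinate -/

section Iterates

variable {X A : Type*} [DecidableEq X]

/-- The stepsize with which the pair `p` is updated at time `t`: zero if `p` is not the pair
observed at that time. -/
noncomputable def effectiveStep (ε : ℕ → X × X → ℝ) (τ τ' : ℕ → Transition X A) (t : ℕ)
    (p : X × X) : ℝ :=
  if ((τ t).state, (τ' t).state) = p then ε t p else 0

/-- A zero step at the unobserved pairs makes the asynchronous update one averaging formula valid at
all pairs. -/
theorem micoIterate_succ_apply (γ : ℝ) (ε : ℕ → X × X → ℝ) (τ τ' : ℕ → Transition X A)
    (U₀ : X × X → ℝ) (t : ℕ) (p : X × X) :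
    micoIterate γ ε τ τ' U₀ (t + 1) p =
      (1 - effectiveStep ε τ τ' t p) * micoIterate γ ε τ τ' U₀ t p + effectiveStep ε τ τ' t p *
        (|(τ t).reward - (τ' t).reward| +
          γ * micoIterate γ ε τ τ' U₀ t ((τ t).next, (τ' t).next)) := by
  by_cases h : ((τ t).state, (τ' t).state) = p
  · subst h
    simp [micoIterate, micoUpdate, effectiveStep]
  · simp [micoIterate, micoUpdate, effectiveStep, h, Function.update_of_ne (Ne.symm h)]

/-- No upper bound on the stepsizes is assumed; summable squares tend to zero, which forces the
steps below one eventually. -/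
theorem RobbinsMonro.eventually_effectiveStep {ε : ℕ → X × X → ℝ} {τ τ' : ℕ → Transition X A}
    {p : X × X} (h : RobbinsMonro ε τ τ' p) :
    ∀ᶠ t in atTop, 0 ≤ effectiveStep ε τ τ' t p ∧ effectiveStep ε τ τ' t p ≤ 1 := by
  filter_upwards [h.summable_sq.tendsto_atTop_zero.eventually (gt_mem_nhds one_pos)] with t ht
  rw [effectiveStep]
  split_ifs at ht ⊢ with hp
  · exact ⟨h.nonneg t hp, le_of_lt ((sq_lt_one_iff₀ (h.nonneg t hp)).1 ht)⟩
  · simp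

theorem RobbinsMonro.summable_effectiveStep_sq {ε : ℕ → X × X → ℝ} {τ τ' : ℕ → Transition X A}
    {p : X × X} (h : RobbinsMonro ε τ τ' p) :
    Summable fun t => effectiveStep ε τ τ' t p ^ 2 := by
  refine h.summable_sq.congr fun t => ?_
  rw [effectiveStep]
  split_ifs <;> simp

end Iterates

/-! ### Noise and measurability of the sampled transitions -/

section Generated

variable {X A Ω : Type*} {mΩ : MeasurableSpace Ω} {M : MDP X A} {π : X → PMF A}
  {μ : Measure Ω} {ℱ : Filtration ℕ mΩ} {τ τ' : ℕ → Ω → Transition X A}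

/-- This is where state-only rewards are essential: in general the mean of `|r - r̃|` may exceed the
absolute difference of the means, and the limit would change. -/
theorem GeneratedUnder.abs_reward_sub [Fintype A] (hτ : GeneratedUnder M π μ ℱ τ τ')
    (hr : M.StateRewards) (t : ℕ) (ω : Ω) :
    |(τ t ω).reward - (τ' t ω).reward| =
      |M.rPi π (τ t ω).state - M.rPi π (τ' t ω).state| := by
  rw [(hτ.reward_eq t ω).1, (hτ.reward_eq t ω).2, ← hr.rPi_eq π, ← hr.rPi_eq π]

theorem GeneratedUnder.measurableSet_state (hτ : GeneratedUnder M π μ ℱ τ τ') (t : ℕ)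
    (p : X × X) : MeasurableSet[ℱ t] {ω | ((τ t ω).state, (τ' t ω).state) = p} :=
  hτ.measurable_state t (show MeasurableSet[⊤] {p} from trivial)

theorem GeneratedUnder.measurable_comp_state (hτ : GeneratedUnder M π μ ℱ τ τ') (t : ℕ)
    (φ : X × X → ℝ) : Measurable[ℱ t] fun ω => φ ((τ t ω).state, (τ' t ω).state) := by
  have h : Measurable[⊤] φ := measurable_from_top
  exact h.comp (hτ.measurable_state t)

theorem GeneratedUnder.measurableSet_next (hτ : GeneratedUnder M π μ ℱ τ τ') (t : ℕ)
    (q : X × X) : MeasurableSet[ℱ (t + 1)] {ω | ((τ t ω).next, (τ' t ω).next) = q} :=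
  hτ.measurable_outcome t
    (show MeasurableSet[⊤] {o : (A × X) × (A × X) | (o.1.2, o.2.2) = q} from trivial)

variable [DecidableEq X]

/-- The noise in the observation that the next pair of states is `q`. -/
noncomputable def nextNoise (M : MDP X A) (π : X → PMF A) (o o' : Transition X A) (q : X × X) :
    ℝ :=
  (if (o.next, o'.next) = q then 1 else 0) -
    (M.PPi π o.state q.1).toReal * (M.PPi π o'.state q.2).toReal

theorem abs_nextNoise_le (M : MDP X A) (π : X → PMF A) (o o' : Transition X A) (q : X × X) :
    |nextNoise M π o o' q| ≤ 1 := by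
  have h0 : 0 ≤ (M.PPi π o.state q.1).toReal * (M.PPi π o'.state q.2).toReal := by positivity
  have h1 : (M.PPi π o.state q.1).toReal * (M.PPi π o'.state q.2).toReal ≤ 1 :=
    mul_le_one₀ (PMF.toReal_apply_le_one _ _) ENNReal.toReal_nonneg (PMF.toReal_apply_le_one _ _)
  rw [nextNoise, abs_le]
  split_ifs <;> constructor <;> linarith

/-- The sampled target is the MICo operator plus noise. -/
theorem sampled_target_eq [Fintype X] [Fintype A] (M : MDP X A) (π : X → PMF A) (o o' : Transition X A)
    (U : X × X → ℝ) :
    |M.rPi π o.state - M.rPi π o'.state| + M.γ * U (o.next, o'.next) =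
      M.micoOp π U (o.state, o'.state) + M.γ * ∑ q, U q * nextNoise M π o o' q := by
  have h : ∑ q, U q * nextNoise M π o o' q = U (o.next, o'.next) - ∑ x', ∑ y',
      (M.PPi π o.state x').toReal * (M.PPi π o'.state y').toReal * U (x', y') := by
    simp only [nextNoise, mul_sub, Finset.sum_sub_distrib, mul_ite, mul_one, mul_zero,
      Finset.sum_ite_eq, Finset.mem_univ, if_true]
    rw [Fintype.sum_prod_type]
    simp only [mul_comm (U _)]
  rw [h, MDP.micoOp]
  ring

theorem GeneratedUnder.measurable_nextNoise (hτ : GeneratedUnder M π μ ℱ τ τ') (t : ℕ)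
    (q : X × X) : Measurable[ℱ (t + 1)] fun ω => nextNoise M π (τ t ω) (τ' t ω) q := by
  refine (Measurable.ite (hτ.measurableSet_next t q) measurable_const measurable_const).sub ?_
  exact (hτ.measurable_comp_state t fun p => (M.PPi π p.1 q.1).toReal *
    (M.PPi π p.2 q.2).toReal).mono (ℱ.mono t.le_succ) le_rfl

/-- The event that the next pair is `q` splits over the pairs of actions; the sum of the conditional
laws factors into the product of the two `PPi` probabilities. -/
theorem GeneratedUnder.condExp_nextNoise [Fintype A] [IsProbabilityMeasure μ]
    (hτ : GeneratedUnder M π μ ℱ τ τ') (t : ℕ) (q : X × X) :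
    μ[fun ω => nextNoise M π (τ t ω) (τ' t ω) q | ℱ t] =ᵐ[μ] 0 := by
  classical
  set E : A × A → Set Ω := fun c => {ω | ((τ t ω).action = c.1 ∧ (τ t ω).next = q.1) ∧
    ((τ' t ω).action = c.2 ∧ (τ' t ω).next = q.2)}
  set κ : Ω → ℝ := fun ω =>
    (M.PPi π (τ t ω).state q.1).toReal * (M.PPi π (τ' t ω).state q.2).toReal
  have hE : ∀ c, MeasurableSet (E c) := fun c => ℱ.le (t + 1) _ <|
    hτ.measurable_outcome t (show MeasurableSet[⊤] {o : (A × X) × (A × X) |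
      (o.1.1 = c.1 ∧ o.1.2 = q.1) ∧ o.2.1 = c.2 ∧ o.2.2 = q.2} from trivial)
  have hEi : ∀ c, Integrable ((E c).indicator fun _ => (1 : ℝ)) μ := fun c =>
    (integrable_const 1).indicator (hE c)
  have hκF : Measurable[ℱ t] κ := hτ.measurable_comp_state t fun p =>
    (M.PPi π p.1 q.1).toReal * (M.PPi π p.2 q.2).toReal
  have hκi : Integrable κ μ := by
    refine .of_bound (hκF.mono (ℱ.le _) le_rfl).aestronglyMeasurable 1 (ae_of_all _ fun ω => ?_)
    rw [Real.norm_eq_abs, abs_of_nonneg (by positivity)]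
    exact mul_le_one₀ (PMF.toReal_apply_le_one _ _) ENNReal.toReal_nonneg
      (PMF.toReal_apply_le_one _ _)
  have heq : (fun ω => nextNoise M π (τ t ω) (τ' t ω) q) =
      (∑ c, (E c).indicator fun _ => (1 : ℝ)) - κ := by
    ext ω
    simp only [nextNoise, Pi.sub_apply, Finset.sum_apply, κ]
    congr 1
    rw [Finset.sum_eq_single ((τ t ω).action, (τ' t ω).action)]
    · simp [E, Set.indicator_apply, Prod.ext_iff]
    · rintro ⟨a, b⟩ - hne
      refine Set.indicator_of_notMem (fun h => hne ?_) _
      exact Prod.ext h.1.1.symm h.2.1.symm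
    · simp
  rw [heq]
  have h1 := condExp_finsetSum (s := Finset.univ) (fun c _ => hEi c) (ℱ t)
  have h2 := condExp_sub (m := ℱ t) (integrable_finsetSum' Finset.univ fun c _ => hEi c) hκi
  rw [condExp_of_stronglyMeasurable (ℱ.le t) hκF.stronglyMeasurable hκi] at h2
  filter_upwards [h1, h2, ae_all_iff.2 fun c : A × A => hτ.cond_law t c.1 c.2 q.1 q.2]
    with ω h1 h2 h3
  have h4 : ∑ c, μ[(E c).indicator fun _ => (1 : ℝ) | ℱ t] ω = κ ω := by
    simp only [κ, MDP.toReal_PPi, Finset.sum_mul_sum, ← Fintype.sum_prod_type']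
    exact Finset.sum_congr rfl fun c _ => h3 c
  rw [h2, Pi.sub_apply, h1, Finset.sum_apply, h4, sub_self, Pi.zero_apply]

theorem GeneratedUnder.measurable_effectiveStep (hτ : GeneratedUnder M π μ ℱ τ τ')
    {ε : ℕ → Ω → X × X → ℝ} (hε : ∀ t p, Measurable[ℱ t] (fun ω => ε t ω p)) (t : ℕ)
    (p : X × X) : Measurable[ℱ t] fun ω =>
      effectiveStep (fun s => ε s ω) (fun s => τ s ω) (fun s => τ' s ω) t p :=
  Measurable.ite (hτ.measurableSet_state t p) (hε t p) measurable_const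

theorem GeneratedUnder.measurable_apply_next [Fintype X] (hτ : GeneratedUnder M π μ ℱ τ τ')
    {t : ℕ} {W : Ω → X × X → ℝ} (hW : ∀ q, Measurable[ℱ t] fun ω => W ω q) :
    Measurable[ℱ (t + 1)] fun ω => W ω ((τ t ω).next, (τ' t ω).next) := by
  have h : ∀ ω, W ω ((τ t ω).next, (τ' t ω).next) =
      ∑ q, if ((τ t ω).next, (τ' t ω).next) = q then W ω q else 0 := fun ω => by
    rw [Finset.sum_ite_eq, if_pos (Finset.mem_univ _)]
  simp only [h]
  exact Finset.measurable_fun_sum _ fun q _ => Measurable.ite (hτ.measurableSet_next t q)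
    ((hW q).mono (ℱ.mono t.le_succ) le_rfl) measurable_const

theorem GeneratedUnder.measurable_micoIterate [Fintype X] [Fintype A]
    (hτ : GeneratedUnder M π μ ℱ τ τ')
    (hr : M.StateRewards) {ε : ℕ → Ω → X × X → ℝ}
    (hε : ∀ t p, Measurable[ℱ t] (fun ω => ε t ω p)) {U₀ : Ω → X × X → ℝ}
    (hU₀ : ∀ p, Measurable[ℱ 0] (fun ω => U₀ ω p)) (t : ℕ) (p : X × X) :
    Measurable[ℱ t] fun ω => micoIterate M.γ (fun s => ε s ω) (fun s => τ s ω)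
      (fun s => τ' s ω) (U₀ ω) t p := by
  induction t generalizing p with
  | zero => exact hU₀ p
  | succ t ih =>
    have hstep := (hτ.measurable_effectiveStep hε t p).mono (ℱ.mono t.le_succ) le_rfl
    have hrew : Measurable[ℱ (t + 1)] fun ω => |(τ t ω).reward - (τ' t ω).reward| := by
      simp only [hτ.abs_reward_sub hr]
      obtain ⟨c, hc⟩ : ∃ c : X × X → ℝ, ∀ x y, c (x, y) = |M.rPi π x - M.rPi π y| :=
        ⟨fun p => |M.rPi π p.1 - M.rPi π p.2|, fun _ _ => rfl⟩
      simp only [← hc]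
      exact (hτ.measurable_comp_state t c).mono (ℱ.mono t.le_succ) le_rfl
    have hnext := hτ.measurable_apply_next ih
    have hcur := (ih p).mono (ℱ.mono t.le_succ) le_rfl
    simp only [micoIterate_succ_apply]
    exact ((measurable_const.sub hstep).mul hcur).add (hstep.mul (hrew.add (hnext.const_mul _)))

end Generated

/-! ### Almost sure convergence of the iterates -/

theorem mainTheorem5 {X A Ω : Type*} [Fintype X] [DecidableEq X] [Fintype A]
    {mΩ : MeasurableSpace Ω} (μ : Measure Ω) [IsProbabilityMeasure μ] (ℱ : Filtration ℕ mΩ)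
    (M : MDP X A) (hr : M.StateRewards) (π : X → PMF A)
    (τ τ' : ℕ → Ω → Transition X A) (hτ : GeneratedUnder M π μ ℱ τ τ')
    (ε : ℕ → Ω → X × X → ℝ) (hε : ∀ t p, Measurable[ℱ t] (fun ω => ε t ω p))
    (U₀ : Ω → X × X → ℝ) (hU₀ : ∀ p, Measurable[ℱ 0] (fun ω => U₀ ω p))
    (hio : ∀ᵐ ω ∂μ, ∀ p, UpdatedInfinitelyOften (fun t => τ t ω) (fun t => τ' t ω) p)
    (hRM : ∀ᵐ ω ∂μ, ∀ p,
      RobbinsMonro (fun t => ε t ω) (fun t => τ t ω) (fun t => τ' t ω) p) :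
    ∀ᵐ ω ∂μ, Tendsto
      (fun t => micoIterate M.γ (fun s => ε s ω) (fun s => τ s ω) (fun s => τ' s ω) (U₀ ω) t)
      atTop (𝓝 (M.UPi π)) := by
  have hγ0 := M.γ_nonneg
  set U : ℕ → Ω → X × X → ℝ := fun t ω =>
    micoIterate M.γ (fun s => ε s ω) (fun s => τ s ω) (fun s => τ' s ω) (U₀ ω) t
  set α : ℕ → Ω → X × X → ℝ := fun t ω =>
    effectiveStep (fun s => ε s ω) (fun s => τ s ω) (fun s => τ' s ω) t
  -- The reward gap as a table on pairs, so that its sup norm `‖c‖` can serve as the constant `R`.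
  obtain ⟨c, hc⟩ : ∃ c : X × X → ℝ, ∀ x y, c (x, y) = |M.rPi π x - M.rPi π y| :=
    ⟨fun p => |M.rPi π p.1 - M.rPi π p.2|, fun _ _ => rfl⟩
  have hUsucc : ∀ t ω p, U (t + 1) ω p = (1 - α t ω p) * U t ω p + α t ω p *
      (c ((τ t ω).state, (τ' t ω).state) + M.γ * U t ω ((τ t ω).next, (τ' t ω).next)) :=
    fun t ω p => by
      simp only [hc, U, ← hτ.abs_reward_sub hr]
      exact micoIterate_succ_apply _ _ _ _ _ _ _
  have hbdd : ∀ᵐ ω ∂μ, ∃ B, ∀ᶠ t in atTop, ‖U t ω‖ ≤ B := by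
    filter_upwards [hRM] with ω h
    refine exists_eventually_norm_le_of_averaging (α := fun t => α t ω) (R := ‖c‖) M.γ_lt_one
      (fun p => (h p).eventually_effectiveStep) (fun t p => ?_) hγ0 fun t p => hUsucc t ω p
    refine (abs_add_le _ _).trans (add_le_add (norm_le_pi_norm c _) ?_)
    rw [abs_mul, abs_of_nonneg hγ0]
    exact mul_le_mul_of_nonneg_left (norm_le_pi_norm (U t ω) _) hγ0
  have hnoise : ∀ p q, ∀ᵐ ω ∂μ, ∃ l, Tendsto (fun n => ∑ t ∈ Finset.range n,
      α t ω p * U t ω q * nextNoise M π (τ t ω) (τ' t ω) q) atTop (𝓝 l) := fun p q => by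
    refine ae_exists_tendsto_transform_of_summable_sq (f := fun t ω => α t ω p * U t ω q)
      (fun t => (hτ.measurable_effectiveStep hε t p).mul
        (hτ.measurable_micoIterate hr hε hU₀ t q))
      (fun t => hτ.measurable_nextNoise t q) (fun t ω => abs_nextNoise_le _ _ _ _ _)
      (fun t => hτ.condExp_nextNoise t q) ?_
    -- Eventually the squared weights are at most `B ^ 2` times the squared steps.
    filter_upwards [hbdd, hRM] with ω ⟨B, hB⟩ h
    refine Summable.of_norm_bounded_eventually_nat
      ((h p).summable_effectiveStep_sq.mul_right (B ^ 2)) ?_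
    filter_upwards [hB] with t ht
    rw [Real.norm_eq_abs, abs_of_nonneg (sq_nonneg _), mul_pow, ← sq_abs (U t ω q)]
    exact mul_le_mul_of_nonneg_left
      (pow_le_pow_left₀ (abs_nonneg _) ((norm_le_pi_norm (U t ω) q).trans ht) 2) (sq_nonneg _)
  filter_upwards [hbdd, hRM, ae_all_iff.2 fun p => ae_all_iff.2 fun q => hnoise p q]
    with ω ⟨B, hB⟩ h hl
  have hfix : M.micoOp π (M.UPi π) = M.UPi π := (M.micoOp_contracting π).fixedPoint_isFixedPt
  rw [tendsto_iff_norm_sub_tendsto_zero, ← tendsto_zero_iff_norm_tendsto_zero]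
  -- The drift uses the full operator at every pair and the noise is the same for all pairs; this is
  -- harmless, as both are multiplied by a zero step away from the observed pair.
  refine tendsto_zero_of_contracting_recursion (α := fun t => α t ω)
    (V := fun t => U t ω - M.UPi π) (g := fun t => M.micoOp π (U t ω) - M.UPi π)
    (w := fun t _ => M.γ * ∑ q, U t ω q * nextNoise M π (τ t ω) (τ' t ω) q)
    (B := B + ‖M.UPi π‖) hγ0 M.γ_lt_one (fun p => (h p).eventually_effectiveStep)
    (fun p => (h p).sum_eq_top) (fun p => ?_) (fun t p => ?_) (fun t p => ?_) ?_
  · choose l hl using hl p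
    refine ⟨M.γ * ∑ q, l q, ((tendsto_finsetSum Finset.univ fun q _ => hl q).const_mul
      M.γ).congr fun n => ?_⟩
    rw [Finset.sum_comm, Finset.mul_sum]
    refine Finset.sum_congr rfl fun t _ => ?_
    rw [mul_left_comm, Finset.mul_sum, Finset.mul_sum, Finset.mul_sum]
    simp only [mul_assoc]
  · have h1 : dist (M.micoOp π (U t ω)) (M.micoOp π (M.UPi π)) ≤ M.γ * dist (U t ω) (M.UPi π) :=
      (M.micoOp_contracting π).2.dist_le_mul _ _
    rw [hfix, dist_eq_norm, dist_eq_norm] at h1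
    exact (norm_le_pi_norm (M.micoOp π (U t ω) - M.UPi π) p).trans h1
  · by_cases hp : ((τ t ω).state, (τ' t ω).state) = p
    · rw [Pi.sub_apply, hUsucc, hc, sampled_target_eq, hp, Pi.sub_apply, Pi.sub_apply]
      ring
    · have h0 : α t ω p = 0 := if_neg hp
      simp [hUsucc, h0]
  · filter_upwards [hB] with t ht
    exact (norm_sub_le _ _).trans (by linarith)
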